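/- Notation. Let $S$ be a commutative algebra over a commutative ring $R$ and $M$ an $R$-module; all tensor products are over $R$ unless indicated. For $n\ge 0$ put $B_n(S,M)=T_n(S,M)=S^{\otimes n}\otimes_R M$, with $[a_0|\cdots|a_{n-1}]m=a_0\otimes\cdots\otimes a_{n-1}\otimes m$. The operators on these modules are the face maps multiplying two neighbouring entries, $[\cdots|a_i|a_{i+1}|\cdots]m\mapsto[\cdots|a_ia_{i+1}|\cdots]m$, the degeneracies inserting $1$ after an entry $a_i$, and, if $M$ is an $S$-module, the last face $[a_0|\cdots|a_n]m\mapsto[a_0|\cdots|a_{n-1}]a_nm$ of the one-sided bar construction. For an $S$-module $M$ and an $R$-submodule $N\subseteq M$ we write $B_\bullet(S,M)\cong B_\bullet(S,N)[1]$ (and likewise $T_\bullet(S,M)\cong T_\bullet(S,N)[1]$) if for every $n\ge0$ the $R$-linear map $$S^{\otimes (n+1)}\otimes_R N\longrightarrow S^{\otimes n}\otimes_R M,\qquad [a_0|\cdots|a_n]m\mapsto[a_0|\cdots|a_{n-1}]a_nm$$ is an isomorphism $B_{n+1}(S,N)\cong B_n(S,M)$, and these isomorphisms carry the multiplication faces and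 degeneracies of $B_\bullet(S,N)$ in degree $n+1$ to the faces (including the last one) and degeneracies of $B_\bullet(S,M)$ in degree $n$ (multiplication of the last two algebra entries corresponds to the last face; the operators inserting $1$ in the last place have no counterpart and are dropped). For a Hopf algebra $A$ and a left $A$-module $V$ put $V^A=\{v: av=\varepsilon(a)v\ \forall a\in A\}$, let $I=A^A$ be the left integrals of $A$, and call $V^A/IV$ the Hopfological homology of $V$. If $S$ is a left $A$-module algebra, an $S\#A$-module is an $S$-module $M$ with a left $A$-action such that $a(sm)=\sum(a_1s)(a_2m)$; and $j:S\otimes A\to\mathrm{End}_R(S)$ is $j(s\otimes a)(t)=s\,(at)$. "Finite" means finitely generated projective as a module. Theorem. (A) Let $R$ be a commutative local ring, $\mathcal A$ a finite $R$-Hopf algebra with bijective antipode, and $S$ a finite commutative $R$-algebra which is a left $\mathcal A$-module algebra, faithful as an $\mathcal A$-module, with $S^{\mathcal A}=R$. Let $M$ be an $S\#\mathcal A$-module. (i) If $j:S\#\mathcal A\to \mathrm{End}_R(S)$ is an isomorphism, then $B_\bullet(S,M)\cong B_\bullet(S,M^{\mathcal A})[1]$; in particular $B_n(S,M)\cong B_{n+1}(S,M^{\mathcal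 A})$ for all $n\ge0$. (ii) If $\mathcal A$ is local (as a ring) and cocommutative, $\mathrm{rank}_R(S)=\mathrm{rank}_R(\mathcal A)$, and the Hopfological homology of $S$ is zero, then $B_\bullet(S,M)\cong B_\bullet(S,M^{\mathcal A})[1]$. (B) Let $K$ be a field, $\mathcal H$ a Hopf algebra over $K$, $S$ a commutative $K$-algebra which is a left $\mathcal H$-module algebra, and $H\subset\mathcal H$ a finite-dimensional Hopf subalgebra with bijective antipode. Let $H^*=\mathrm{Hom}_K(H,K)$, let $\sigma:S\to S\otimes_KH^*$, $\sigma(s)=\sum s_0\otimes s_1$ with $hs=\sum s_1(h)s_0$, be the coaction induced by the restricted action of $H$, and let $R=S^{coH^*}=\{s:\sigma(s)=s\otimes1\}$. Assume that $S$ is finite and faithfully flat over $R$, that $H$ acts faithfully on $S$, and that $S/R$ is a Hopf–Galois extension with $H$, i.e. $\gamma:S\otimes_RS\to S\otimes_KH^*$, $\gamma(s\otimes t)=(s\otimes1)\sigma(t)$, is bijective. Let $M$ be a relative $(S,H^*)$-Hopf module, i.e. an $S$-module with a right $H^*$-comodule structure $\rho:M\to M\otimes_KH^*$ such that $\rho(sm)=\sigma(s)\rho(m)$,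 and let $M^{coH^*}=\{m:\rho(m)=m\otimes1\}$. Then $T_\bullet(S,M)\cong T_\bullet(S,M^{coH^*})[1]$; in particular $T_n(S,M)\cong T_{n+1}(S,M^{coH^*})$ for all $n\ge0$. -/

import Mathlib

open scoped TensorProduct

noncomputable section

namespace HopfShift

/-! ## Module algebras, smash product modules, invariants, integrals -/

section Hopf

variable {R A V S M : Type*} [CommRing R] [Ring A] [HopfAlgebra R A]
  [AddCommGroup V] [Module R V]
  [CommRing S] [Algebra R S] [AddCommGroup M] [Module R M] [Module S M] [IsScalarTower R S M]

/-- The invariants `V^A = {v | a v = ε(a) v for all a}` of a left `A`-module `V`, the action being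
given by an algebra homomorphism `A → End_R(V)`. -/
def invariants (act : A →ₐ[R] Module.End R V) : Submodule R V where
  carrier := {v | ∀ a : A, act a v = (Coalgebra.counit (R := R) a) • v}
  add_mem' := fun {v w} hv hw a => by
    simp only [Set.mem_ofPred_eq] at hv hw
    rw [map_add, hv a, hw a, smul_add]
  zero_mem' := fun a => by simp
  smul_mem' := fun c v hv a => by
    simp only [Set.mem_ofPred_eq] at hv
    rw [map_smul, hv a, smul_comm]

variable (R A) in
/-- The left integrals `I = A^A = {x | h x = ε(h) x for all h}` of `A`. -/
def leftIntegrals : Submodule R A := invariants (Algebra.lmul R A)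

/-- `I V`, the `R`-span of all `x v` with `x` a left integral and `v ∈ V`. -/
def integralImage (act : A →ₐ[R] Module.End R V) : Submodule R V :=
  Submodule.map₂ act.toLinearMap (leftIntegrals R A) ⊤

/-- The Hopfological homology `V^A / I V` of a left `A`-module `V`. -/
abbrev HopfologicalHomology (act : A →ₐ[R] Module.End R V) : Type _ :=
  invariants act ⧸ (integralImage act).submoduleOf (invariants act)

/-- `∑ (a₁ s) • (a₂ m)`, where `Δ a = ∑ a₁ ⊗ a₂`. -/
def diagonalSMul (act : A →ₐ[R] Module.End R S) (actM : A →ₐ[R] Module.End R M)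
    (a : A) (s : S) (m : M) : M :=
  TensorProduct.lift (Algebra.lsmul R R M : S →ₐ[R] Module.End R M).toLinearMap
    (TensorProduct.map₂ act.toLinearMap actM.toLinearMap (Coalgebra.comul (R := R) a) (s ⊗ₜ[R] m))

/-- `S` is a left `A`-module algebra:
`a (s t) = ∑ (a₁ s) (a₂ t)` and `a 1 = ε(a) 1`. -/
structure IsModuleAlgebra (act : A →ₐ[R] Module.End R S) : Prop where
  act_mul : ∀ (a : A) (s t : S), act a (s * t) = diagonalSMul act act a s t
  act_one : ∀ a : A, act a 1 = algebraMap R S (Coalgebra.counit (R := R) a)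

/-- The `S`-module `M` with its left `A`-action is a left module over the smash product `S # A`
(where `(s # a) m = s (a m)`, and `(1 # a) (s # 1) = ∑ (a₁ s) # a₂`):
`a (s m) = ∑ (a₁ s) (a₂ m)`. -/
def IsSmashModule (act : A →ₐ[R] Module.End R S) (actM : A →ₐ[R] Module.End R M) : Prop :=
  ∀ (a : A) (s : S) (m : M), actM a (s • m) = diagonalSMul act actM a s m

/-- `A` acts faithfully. -/
def IsFaithfulAction (act : A →ₐ[R] Module.End R V) : Prop :=
  ∀ a : A, (∀ v : V, act a v = 0) → a = 0

/-- `S^A = R`. -/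
def InvariantsEqBase (act : A →ₐ[R] Module.End R S) : Prop :=
  Function.Injective (algebraMap R S) ∧
    ∀ s : S, s ∈ invariants act ↔ s ∈ Set.range (algebraMap R S)

/-- `j : S # A = S ⊗ A → End_R(S)`, `j (s ⊗ a) t = s (a t)`. -/
def jMap (act : A →ₐ[R] Module.End R S) : S ⊗[R] A →ₗ[R] Module.End R S :=
  TensorProduct.lift
    (((LinearMap.mul R (Module.End R S)).compl₂ act.toLinearMap).comp (Algebra.lmul R S).toLinearMap)

theorem jMap_tmul (act : A →ₐ[R] Module.End R S) (s : S) (a : A) (t : S) :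
    jMap act (s ⊗ₜ[R] a) t = s * act a t := by
  simp [jMap]

end Hopf

/-! ## The modules `S^{⊗ n} ⊗ M` and the operators on them -/

section Bar

variable (R S : Type*) [CommRing R] [CommRing S] [Algebra R S]

/-- `S^{⊗ n} ⊗_R M`; this is `B_n(S, M)`, and also `T_n(S, M)`. -/
abbrev Bar (M : Type*) [AddCommGroup M] [Module R M] (n : ℕ) : Type _ :=
  (⨂[R] _ : Fin n, S) ⊗[R] M

variable {R S} in
theorem contractNth_update {n : ℕ} (i : Fin (n + 1)) [DecidableEq (Fin (n + 2))]
    (a : Fin (n + 2) → S) (k : Fin (n + 2)) :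
    ∃ (k' : Fin (n + 1)) (f : S →ₗ[R] S), ∀ x : S,
      Fin.contractNth i.castSucc (· * ·) (Function.update a k x) =
        Function.update (Fin.contractNth i.castSucc (· * ·) a) k' (f x) := by
  obtain ⟨k, hk⟩ := k
  obtain ⟨i, hi⟩ := i
  rcases lt_trichotomy k i with h | h | h
  · refine ⟨⟨k, by omega⟩, LinearMap.id, fun x => ?_⟩
    ext ⟨l, hl⟩
    simp only [Fin.contractNth, Function.update_apply, Fin.ext_iff, Fin.val_castSucc, Fin.val_succ,
      LinearMap.id_apply]
    grind
  · refine ⟨⟨i, hi⟩, LinearMap.mulRight R (a ⟨i + 1, by omega⟩), fun x => ?_⟩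
    ext ⟨l, hl⟩
    simp only [Fin.contractNth, Function.update_apply, Fin.ext_iff, Fin.val_castSucc, Fin.val_succ,
      LinearMap.mulRight_apply, Fin.succ_mk, Fin.castSucc_mk]
    grind
  · by_cases h' : k = i + 1
    · refine ⟨⟨i, hi⟩, LinearMap.mulLeft R (a ⟨i, by omega⟩), fun x => ?_⟩
      ext ⟨l, hl⟩
      simp only [Fin.contractNth, Function.update_apply, Fin.ext_iff, Fin.val_castSucc,
        Fin.val_succ, LinearMap.mulLeft_apply, Fin.succ_mk, Fin.castSucc_mk]
      grind
    · refine ⟨⟨k - 1, by omega⟩, LinearMap.id, fun x => ?_⟩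
      ext ⟨l, hl⟩
      simp only [Fin.contractNth, Function.update_apply, Fin.ext_iff, Fin.val_castSucc,
        Fin.val_succ, LinearMap.id_apply]
      grind

/-- `(a_0, …, a_{n+1}) ↦ a_0 ⊗ ⋯ ⊗ a_i a_{i+1} ⊗ ⋯ ⊗ a_{n+1}` as a multilinear map. -/
def contractMultilinear {n : ℕ} (i : Fin (n + 1)) :
    MultilinearMap R (fun _ : Fin (n + 2) => S) (⨂[R] _ : Fin (n + 1), S) where
  toFun a := PiTensorProduct.tprod R (Fin.contractNth i.castSucc (· * ·) a)
  map_update_add' a k x y := by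
    obtain ⟨k', f, h⟩ := contractNth_update (R := R) i a k
    simp only [h, map_add, MultilinearMap.map_update_add]
  map_update_smul' a k c x := by
    obtain ⟨k', f, h⟩ := contractNth_update (R := R) i a k
    simp only [h, map_smul, MultilinearMap.map_update_smul]

variable {R S} {M : Type*} [AddCommGroup M] [Module R M]

/-- `[a_0|⋯|a_{n+1}] m ↦ [a_0|⋯|a_i a_{i+1}|⋯|a_{n+1}] m`. -/
def mulFace {n : ℕ} (i : Fin (n + 1)) : Bar R S M (n + 2) →ₗ[R] Bar R S M (n + 1) :=
  (PiTensorProduct.lift (contractMultilinear R S i)).rTensor M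

/-- `[a_0|⋯|a_n] m ↦ [a_0|⋯|a_i|1|a_{i+1}|⋯|a_n] m`. -/
def degen {n : ℕ} (i : Fin (n + 1)) : Bar R S M (n + 1) →ₗ[R] Bar R S M (n + 2) :=
  (PiTensorProduct.lift (MultilinearMap.curryMid i.succ
    (PiTensorProduct.tprod R (s := fun _ : Fin (n + 2) => S)) (1 : S))).rTensor M

/-- The last face `[a_0|⋯|a_n] m ↦ [a_0|⋯|a_{n-1}] a_n m`. -/
def actFace {n : ℕ} [Module S M] [IsScalarTower R S M] :
    Bar R S M (n + 1) →ₗ[R] Bar R S M n :=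
  TensorProduct.lift (PiTensorProduct.lift (MultilinearMap.uncurryRight
    ((((LinearMap.llcomp R M M (Bar R S M n)).comp
        (TensorProduct.mk R (⨂[R] _ : Fin n, S) M)).compl₂
      (Algebra.lsmul R R M : S →ₐ[R] Module.End R M).toLinearMap).compMultilinearMap
        (PiTensorProduct.tprod R))))

theorem mulFace_tmul {n : ℕ} (i : Fin (n + 1)) (a : Fin (n + 2) → S) (m : M) :
    mulFace i (PiTensorProduct.tprod R a ⊗ₜ[R] m) =
      PiTensorProduct.tprod R (Fin.contractNth i.castSucc (· * ·) a) ⊗ₜ[R] m := by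
  simp [mulFace, contractMultilinear]

theorem degen_tmul {n : ℕ} (i : Fin (n + 1)) (a : Fin (n + 1) → S) (m : M) :
    degen i (PiTensorProduct.tprod R a ⊗ₜ[R] m) =
      PiTensorProduct.tprod R (i.succ.insertNth (1 : S) a : Fin (n + 2) → S) ⊗ₜ[R] m := by
  simp [degen]

theorem actFace_tmul {n : ℕ} [Module S M] [IsScalarTower R S M] (a : Fin (n + 1) → S) (m : M) :
    actFace (PiTensorProduct.tprod R a ⊗ₜ[R] m) =
      PiTensorProduct.tprod R (Fin.init a) ⊗ₜ[R] (a (Fin.last n) • m) := by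
  simp [actFace]

end Bar

/-! ## Comodules over the dual `H^*` of a finite dimensional Hopf algebra -/

section Dual

variable {K H S M : Type*} [Field K] [Ring H] [HopfAlgebra K H]
  [CommRing S] [Algebra K S] [AddCommGroup M] [Module K M] [Module S M] [IsScalarTower K S M]

/-- The product of `H^*`: `(f g)(h) = ∑ f(h₁) g(h₂)`; its unit is the counit of `H`. -/
def dualMul : Module.Dual K H →ₗ[K] Module.Dual K H →ₗ[K] Module.Dual K H :=
  TensorProduct.curry
    ((Coalgebra.comul (R := K) (A := H)).dualMap.comp (TensorProduct.dualDistrib K H H))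

theorem dualMul_one_one :
    dualMul (Coalgebra.counit : Module.Dual K H) Coalgebra.counit = Coalgebra.counit := by
  ext h
  have h1 : TensorProduct.dualDistrib K H H
      ((Coalgebra.counit : Module.Dual K H) ⊗ₜ[K] (Coalgebra.counit : Module.Dual K H)) =
      (Coalgebra.counit : H →ₗ[K] K).comp ((TensorProduct.lid K H).toLinearMap.comp
        ((Coalgebra.counit : H →ₗ[K] K).rTensor H)) := by
    ext x y
    simp
  simp [dualMul, h1]

/-- The coproduct of `H^*`: `Δ f = ∑ f₁ ⊗ f₂` with `∑ f₁(x) f₂(y) = f(x y)`. -/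
def dualComul [Module.Finite K H] :
    Module.Dual K H →ₗ[K] Module.Dual K H ⊗[K] Module.Dual K H :=
  (TensorProduct.dualDistribEquiv K H H).symm.toLinearMap.comp (LinearMap.mul' K H).dualMap

/-- The counit of `H^*`: `f ↦ f(1)`. -/
def dualCounit : Module.Dual K H →ₗ[K] K := LinearMap.applyₗ (1 : H)

/-- The right `H^*`-coaction `σ(s) = ∑ s₀ ⊗ s₁` induced by a left `H`-action:
`h s = ∑ s₁(h) s₀`. -/
def inducedCoaction [Module.Finite K H] (act : H →ₐ[K] Module.End K S) :
    S →ₗ[K] S ⊗[K] Module.Dual K H :=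
  ((TensorProduct.comm K (Module.Dual K H) S).toLinearMap.comp
    (dualTensorHomEquiv K H S).symm.toLinearMap).comp act.toLinearMap.flip

/-- `(s ⊗ f) (m ⊗ g) = s m ⊗ f g`. -/
def tensorSMul :
    S ⊗[K] Module.Dual K H →ₗ[K] M ⊗[K] Module.Dual K H →ₗ[K] M ⊗[K] Module.Dual K H :=
  TensorProduct.map₂ (Algebra.lsmul K K M : S →ₐ[K] Module.End K M).toLinearMap dualMul

/-- `M`, an `S`-module with a right `H^*`-coaction `ρ`, is a relative `(S, H^*)`-Hopf module, where
`σ` is the coaction of the `H^*`-comodule algebra `S`: `ρ` is coassociative and counital, and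
`ρ(s m) = σ(s) ρ(m)`. -/
structure IsRelativeHopfModule [Module.Finite K H] (σ : S →ₗ[K] S ⊗[K] Module.Dual K H)
    (ρ : M →ₗ[K] M ⊗[K] Module.Dual K H) : Prop where
  coassoc : ∀ m : M, TensorProduct.assoc K M (Module.Dual K H) (Module.Dual K H)
      (ρ.rTensor (Module.Dual K H) (ρ m)) = (dualComul (K := K) (H := H)).lTensor M (ρ m)
  counit : ∀ m : M, TensorProduct.rid K M ((dualCounit (K := K) (H := H)).lTensor M (ρ m)) = m
  smul : ∀ (s : S) (m : M), ρ (s • m) = tensorSMul (σ s) (ρ m)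

variable {R : Type*} [CommRing R] [Algebra R S] [Module R M] [IsScalarTower R S M]

/-- `R = S^{co H^*} = {s | σ(s) = s ⊗ 1}`. -/
def CoinvariantsEqBase (R : Type*) [CommRing R] [Algebra R S]
    (σ : S →ₗ[K] S ⊗[K] Module.Dual K H) : Prop :=
  Function.Injective (algebraMap R S) ∧
    ∀ s : S, σ s = s ⊗ₜ[K] (Coalgebra.counit : Module.Dual K H) ↔ s ∈ Set.range (algebraMap R S)

/-- The coinvariants `M^{co H^*} = {m | ρ(m) = m ⊗ 1}` of a relative Hopf module, an `R`-submodule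
of `M`, where `R = S^{co H^*}`. -/
def coinvariants [Module.Finite K H] {σ : S →ₗ[K] S ⊗[K] Module.Dual K H}
    {ρ : M →ₗ[K] M ⊗[K] Module.Dual K H} (hR : CoinvariantsEqBase R σ)
    (hρ : IsRelativeHopfModule σ ρ) : Submodule R M where
  carrier := {m | ρ m = m ⊗ₜ[K] (Coalgebra.counit : Module.Dual K H)}
  add_mem' := fun {v w} hv hw => by
    simp only [Set.mem_ofPred_eq] at hv hw ⊢
    rw [map_add, hv, hw, TensorProduct.add_tmul]
  zero_mem' := by simp
  smul_mem' := fun r m hm => by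
    simp only [Set.mem_ofPred_eq] at hm ⊢
    rw [← algebraMap_smul S r m, hρ.smul, hm, (hR.2 _).2 ⟨r, rfl⟩]
    simp [tensorSMul, dualMul_one_one]

/-- `S / R` is a Hopf-Galois extension with `H`: the map
`γ : S ⊗_R S → S ⊗_K H^*`, `γ(s ⊗ t) = (s ⊗ 1) σ(t)`, is well defined and bijective. -/
def IsHopfGalois (R : Type*) [CommRing R] [Algebra R S]
    (σ : S →ₗ[K] S ⊗[K] Module.Dual K H) : Prop :=
  ∃ γ : S ⊗[R] S ≃ₗ[S] S ⊗[K] Module.Dual K H, ∀ s t : S, γ (s ⊗ₜ[R] t) = s • σ t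

end Dual

/-! ## Degree shift -/

section Shift

variable {R S M : Type*} [CommRing R] [CommRing S] [Algebra R S]
  [AddCommGroup M] [Module R M] [Module S M] [IsScalarTower R S M]

/-- The graded module `S^{⊗ n} ⊗ M` is isomorphic to the degree shift `S^{⊗ (n+1)} ⊗ N` of
`S^{⊗ n} ⊗ N`, by isomorphisms which are induced by the action of `S` on `M` and which carry the
face and degeneracy operators of the one-sided bar construction with coefficients in `M` to those
of the shift (in which the last face of `S^{⊗ (n+1)} ⊗ N`, which would need an action of `S` on
`N`, is dropped). -/
def IsDegreeShift (N : Submodule R M) : Prop :=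
  ∃ e : ∀ n : ℕ, Bar R S N (n + 1) ≃ₗ[R] Bar R S M n,
    (∀ (n : ℕ) (a : Fin (n + 1) → S) (m : N),
      e n (PiTensorProduct.tprod R a ⊗ₜ[R] m) =
        PiTensorProduct.tprod R (Fin.init a) ⊗ₜ[R] (a (Fin.last n) • (m : M))) ∧
    (∀ (n : ℕ) (i : Fin (n + 1)) (x : Bar R S N (n + 3)),
      e (n + 1) (mulFace i.castSucc x) = mulFace i (e (n + 2) x)) ∧
    (∀ (n : ℕ) (x : Bar R S N (n + 2)),
      e n (mulFace (Fin.last n) x) = actFace (e (n + 1) x)) ∧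
    (∀ (n : ℕ) (i : Fin (n + 1)) (x : Bar R S N (n + 2)),
      e (n + 2) (degen i.castSucc x) = degen i (e (n + 1) x))

end Shift

end HopfShift

end

/-! Everything reduces to one descent statement: the map `S ⊗ N → M`, `s ⊗ m ↦ s m`, is bijective,
where `N` is the module of invariants or coinvariants. Tensoring it with `S^{⊗ n}` gives the degree
shift, and compatibility with the operators is checked on pure tensors.

Descent is a Morita argument (`bijective_extendScalars`). Let `e i`, `g i` be a finite dual basis of
`S` over `R`. If `j` is injective and its image contains every `R`-linear endomorphism, then `g i =
j (x i)` for some `x i` in `S # A`. Since `g i` has values in `R`, `a (x i) = ε(a) (x i)`, so `x i`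
maps `M` into `N`; and `∑ e i (x i) = 1`. Hence `m ↦ ∑ e i ⊗ x i m` inverts `S ⊗ N → M`.

For (B), a right `H^*`-comodule is a left `H`-module and coinvariants are invariants. The `S`-dual
of the bijection `γ` identifies `S ⊗ H` with `End_R(S)`, which supplies the hypotheses on `j`.

For (A)(ii), vanishing homology over the local ring `R` yields a left integral `x` and `s` with `x s
= 1`. This forces the invariants of `k ⊗ S` to be the residue field `k`. As `A` is local, every
nonzero finite-dimensional representation on which scalars act as scalars has a nonzero invariant;
applied to a kernel in `(k ⊗ S) ⊗ (k ⊗ S)`, this makes the matrix of `j` invertible modulo the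
maximal ideal, and Nakayama lifts this to `S`. -/

open scoped TensorProduct

namespace HopfShift

/-! ### Degree shift from the bijection `S ⊗ N → M` -/

section Shift

variable {R S M : Type*} [CommRing R] [CommRing S] [Algebra R S]
  [AddCommGroup M] [Module R M] [Module S M] [IsScalarTower R S M]

/-- The map `S ⊗ N → M`, `s ⊗ m ↦ s m`, for a submodule `N` of `M`. -/
noncomputable def extendScalars (N : Submodule R M) : S ⊗[R] N →ₗ[R] M :=
  TensorProduct.lift (((Algebra.lsmul R R M : S →ₐ[R] Module.End R M).toLinearMap).compl₂ N.subtype)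

theorem extendScalars_tmul (N : Submodule R M) (s : S) (m : N) :
    extendScalars N (s ⊗ₜ[R] m) = s • (m : M) := by
  simp [extendScalars]

variable (R S) in
/-- `S^{⊗ (n+1)} ≃ S^{⊗ n} ⊗ S`, splitting off the last entry. -/
noncomputable def splitLast (n : ℕ) :
    (⨂[R] _ : Fin (n + 1), S) ≃ₗ[R] (⨂[R] _ : Fin n, S) ⊗[R] S :=
  ((TensorProduct.congr (LinearEquiv.refl R _)
    (PiTensorProduct.subsingletonEquiv (R := R) (s := fun _ : Fin 1 => S) 0).symm).trans
      (TensorPower.mulEquiv (R := R) (M := S) (n := n) (m := 1))).symm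

theorem splitLast_tprod {n : ℕ} (a : Fin (n + 1) → S) :
    splitLast R S n (PiTensorProduct.tprod R a) =
      PiTensorProduct.tprod R (Fin.init a) ⊗ₜ[R] a (Fin.last n) := by
  rw [splitLast, LinearEquiv.symm_apply_eq, LinearEquiv.trans_apply, TensorProduct.congr_tmul,
    LinearEquiv.refl_apply, PiTensorProduct.subsingletonEquiv_symm_apply']
  have h := TensorPower.tprod_mul_tprod R (Fin.init a) (fun _ : Fin 1 => a (Fin.last n))
  rw [TensorPower.gMul_def] at h
  refine Eq.trans ?_ h.symm
  congr 1
  rw [Fin.append_right_eq_snoc]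
  simp

/-- The isomorphism `S^{⊗ (n+1)} ⊗ N ≃ S^{⊗ n} ⊗ M` induced by `S ⊗ N ≃ M`. -/
noncomputable def shiftEquiv (N : Submodule R M)
    (h : Function.Bijective (extendScalars (S := S) N)) (n : ℕ) :
    Bar R S N (n + 1) ≃ₗ[R] Bar R S M n :=
  (TensorProduct.congr (splitLast R S n) (LinearEquiv.refl R N)).trans
    ((TensorProduct.assoc R _ S N).trans
      (TensorProduct.congr (LinearEquiv.refl R _) (LinearEquiv.ofBijective (extendScalars N) h)))

theorem shiftEquiv_tmul (N : Submodule R M)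
    (h : Function.Bijective (extendScalars (S := S) N)) (n : ℕ) (a : Fin (n + 1) → S) (m : N) :
    shiftEquiv N h n (PiTensorProduct.tprod R a ⊗ₜ[R] m) =
      PiTensorProduct.tprod R (Fin.init a) ⊗ₜ[R] (a (Fin.last n) • (m : M)) := by
  simp [shiftEquiv, splitLast_tprod, extendScalars_tmul]

theorem bar_hom_ext {n : ℕ} {N P : Type*} [AddCommGroup N] [Module R N] [AddCommGroup P]
    [Module R P] {f g : Bar R S N n →ₗ[R] P}
    (h : ∀ (a : Fin n → S) (m : N), f (PiTensorProduct.tprod R a ⊗ₜ[R] m) =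
      g (PiTensorProduct.tprod R a ⊗ₜ[R] m)) : f = g := by
  ext a m
  exact h a m

/-- If `S ⊗ N → M` is bijective, then `S^{⊗ n} ⊗ M` is the degree shift of `S^{⊗ n} ⊗ N`. -/
theorem isDegreeShift_of_bijective (N : Submodule R M)
    (h : Function.Bijective (extendScalars (S := S) N)) : IsDegreeShift (S := S) N := by
  refine ⟨shiftEquiv N h, shiftEquiv_tmul N h, fun n i x => ?_, fun n x => ?_, fun n i x => ?_⟩
  · refine LinearMap.congr_fun (f := (shiftEquiv N h (n + 1)).toLinearMap ∘ₗ mulFace i.castSucc)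
      (g := mulFace i ∘ₗ (shiftEquiv N h (n + 2)).toLinearMap) (bar_hom_ext fun a m => ?_) x
    simp only [LinearMap.comp_apply, LinearEquiv.coe_coe, mulFace_tmul, shiftEquiv_tmul]
    -- A face with index at most `n` multiplies entries strictly before the last one, so it commutes
    -- with splitting off that entry.
    have h1 : Fin.init (Fin.contractNth i.castSucc.castSucc (· * ·) a) =
        Fin.contractNth i.castSucc (· * ·) (Fin.init a) := by
      ext1 ⟨l, hl⟩
      simp only [Fin.contractNth, Fin.init, Fin.val_castSucc, Fin.castSucc_mk, Fin.succ_mk]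
    have h2 : Fin.contractNth i.castSucc.castSucc (· * ·) a (Fin.last (n + 1)) =
        a (Fin.last (n + 2)) := by
      have := i.2
      simp [Fin.contractNth, show ¬ (n + 1 < (i : ℕ)) by omega,
        show ¬ (n + 1 = (i : ℕ)) by omega]
    rw [h1, h2]
  · refine LinearMap.congr_fun (f := (shiftEquiv N h n).toLinearMap ∘ₗ mulFace (Fin.last n))
      (g := actFace ∘ₗ (shiftEquiv N h (n + 1)).toLinearMap) (bar_hom_ext fun a m => ?_) x
    simp only [LinearMap.comp_apply, LinearEquiv.coe_coe, mulFace_tmul, shiftEquiv_tmul,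
      actFace_tmul]
    have h1 : Fin.init (Fin.contractNth (Fin.last n).castSucc (· * ·) a) =
        Fin.init (Fin.init a) := by
      ext1 ⟨l, hl⟩
      simp [Fin.contractNth, Fin.init, hl]
    have h2 : Fin.contractNth (Fin.last n).castSucc (· * ·) a (Fin.last n) =
        Fin.init a (Fin.last n) * a (Fin.last (n + 1)) := by
      simp [Fin.contractNth, Fin.init]
    -- The face multiplying the last two entries becomes the last face because `(a b) m = a (b m)`.
    rw [h1, h2, mul_smul]
  · refine LinearMap.congr_fun (f := (shiftEquiv N h (n + 2)).toLinearMap ∘ₗ degen i.castSucc)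
      (g := degen i ∘ₗ (shiftEquiv N h (n + 1)).toLinearMap) (bar_hom_ext fun a m => ?_) x
    simp only [LinearMap.comp_apply, LinearEquiv.coe_coe, degen_tmul, shiftEquiv_tmul]
    have h1 : Fin.init (i.castSucc.succ.insertNth (1 : S) a : Fin (n + 3) → S) =
        i.succ.insertNth (1 : S) (Fin.init a) := by
      rw [Fin.eq_insertNth_iff]
      refine ⟨by simp [Fin.init], ?_⟩
      ext1 j
      rw [Fin.removeNth_apply, Fin.init, Fin.succ_castSucc, ← Fin.castSucc_succAbove_castSucc,
        Fin.insertNth_apply_succAbove, Fin.init]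
    have h2 : (i.castSucc.succ.insertNth (1 : S) a : Fin (n + 3) → S) (Fin.last (n + 2)) =
        a (Fin.last (n + 1)) := by
      rw [← Fin.succAbove_ne_last_last (a := i.castSucc.succ), Fin.insertNth_apply_succAbove]
      rw [Fin.succ_castSucc]
      exact Fin.castSucc_ne_last _
    rw [h1, h2]

end Shift

/-! ### Smash products and descent along `S # A ≃ End_R(S)` -/

section Smash

variable {K A S M : Type*} [CommRing K] [Ring A] [HopfAlgebra K A]
  [CommRing S] [Algebra K S] [AddCommGroup M] [Module K M] [Module S M] [IsScalarTower K S M]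

/-- The action `(s ⊗ a) m = s (a m)` of `S # A = S ⊗ A` on `M`. -/
noncomputable def smashAction (actM : A →ₐ[K] Module.End K M) : S ⊗[K] A →ₗ[K] Module.End K M :=
  TensorProduct.lift (((LinearMap.mul K (Module.End K M)).compl₂ actM.toLinearMap).comp
    (Algebra.lsmul K K M : S →ₐ[K] Module.End K M).toLinearMap)

theorem smashAction_tmul (actM : A →ₐ[K] Module.End K M) (s : S) (a : A) (m : M) :
    smashAction actM (s ⊗ₜ[K] a) m = s • actM a m := by
  simp [smashAction]

theorem jMap_eq_smashAction (act : A →ₐ[K] Module.End K S) :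
    jMap act = smashAction act := by
  ext s a t
  simp [jMap_tmul, smashAction_tmul]

theorem IsModuleAlgebra.isSmashModule {act : A →ₐ[K] Module.End K S} (h : IsModuleAlgebra act) :
    IsSmashModule act act := fun a s t => h.act_mul a s t

theorem smashAction_smul (actM : A →ₐ[K] Module.End K M) (s : S) (x : S ⊗[K] A) (m : M) :
    smashAction actM (s • x) m = s • smashAction actM x m := by
  induction x with
  | zero => simp
  | tmul t a => simp [TensorProduct.smul_tmul', smashAction_tmul, mul_smul]
  | add x y hx hy => simp [hx, hy]

/-- The product `(s # a) (t # b) = ∑ s (a₁ t) # a₂ b` of the smash product. -/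
noncomputable def smashMul (act : A →ₐ[K] Module.End K S) (s : S) (a : A) (t : S) (b : A) :
    S ⊗[K] A :=
  TensorProduct.map ((LinearMap.mulLeft K s).comp (act.toLinearMap.flip t))
    (LinearMap.mulRight K b) (Coalgebra.comul (R := K) a)

/-- This is the identity `a (t m') = ∑ (a₁ t) (a₂ m')` applied to `m' = b m`. -/
theorem smashAction_smashMul {act : A →ₐ[K] Module.End K S} {actM : A →ₐ[K] Module.End K M}
    (h : IsSmashModule act actM) (s : S) (a : A) (t : S) (b : A) :
    smashAction actM (smashMul act s a t b) =
      smashAction actM (s ⊗ₜ[K] a) * smashAction actM (t ⊗ₜ[K] b) := by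
  ext m
  rw [Module.End.mul_apply, smashAction_tmul, smashAction_tmul, h, diagonalSMul, smashMul]
  induction Coalgebra.comul (R := K) a with
  | zero => simp
  | tmul x y => simp [smashAction_tmul, mul_smul]
  | add x y hx hy => simp only [map_add, LinearMap.add_apply, hx, hy, smul_add]

/-- `S` and `M` being modules over the smash product, products in `S # A` act on both as
compositions. -/
theorem exists_smashAction_eq_mul {act : A →ₐ[K] Module.End K S} {actM : A →ₐ[K] Module.End K M}
    (hS : IsModuleAlgebra act) (h : IsSmashModule act actM) (x y : S ⊗[K] A) :
    ∃ z, jMap act z = jMap act x * jMap act y ∧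
      smashAction actM z = smashAction actM x * smashAction actM y := by
  simp only [jMap_eq_smashAction]
  induction x with
  | zero => exact ⟨0, by simp⟩
  | add x x' hx hx' =>
    obtain ⟨z, hz, hz'⟩ := hx
    obtain ⟨w, hw, hw'⟩ := hx'
    exact ⟨z + w, by simp [hz, hw, add_mul], by simp [hz', hw', add_mul]⟩
  | tmul s a =>
    induction y with
    | zero => exact ⟨0, by simp⟩
    | add x x' hx hx' =>
      obtain ⟨z, hz, hz'⟩ := hx
      obtain ⟨w, hw, hw'⟩ := hx'
      exact ⟨z + w, by simp [hz, hw, mul_add], by simp [hz', hw', mul_add]⟩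
    | tmul t b =>
      exact ⟨smashMul act s a t b, smashAction_smashMul hS.isSmashModule s a t b,
        smashAction_smashMul h s a t b⟩

/-- An invariant `m` behaves like `1 ∈ S`: on both, `a` acts through the counit. -/
theorem smashAction_apply_of_invariant {act : A →ₐ[K] Module.End K S}
    {actM : A →ₐ[K] Module.End K M} (hS : IsModuleAlgebra act) {m : M}
    (hm : ∀ a : A, actM a m = Coalgebra.counit (R := K) a • m) (x : S ⊗[K] A) :
    smashAction actM x m = jMap act x 1 • m := by
  induction x with
  | zero => simp
  | tmul s a =>
    rw [smashAction_tmul, hm, jMap_tmul, hS.act_one, mul_smul, algebraMap_smul]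
  | add x y hx hy => simp [hx, hy, add_smul]

variable {R : Type*} [CommRing R] [Algebra R S] [Module R M] [IsScalarTower R S M]

/-- If every `R`-linear endomorphism of the finite projective `R`-module `S` comes from a unique
element of `S # A`, then `S ⊗ M^A → M` is bijective. -/
theorem bijective_extendScalars {act : A →ₐ[K] Module.End K S} {actM : A →ₐ[K] Module.End K M}
    [Module.Finite R S] [Module.Projective R S]
    (hS : IsModuleAlgebra act) (h : IsSmashModule act actM)
    (hR : ∀ (a : A) (r : R), act a (algebraMap R S r) =
      Coalgebra.counit (R := K) a • algebraMap R S r)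
    (hinj : Function.Injective (jMap act))
    (hsurj : ∀ f : S →ₗ[R] S, ∃ x, ∀ t, jMap act x t = f t) (N : Submodule R M)
    (hN : ∀ m, m ∈ N ↔ ∀ a : A, actM a m = Coalgebra.counit (R := K) a • m) :
    Function.Bijective (extendScalars (S := S) N) := by
  -- `S` is a direct summand of `R^n`; the coordinates give a dual basis.
  obtain ⟨n, p, q, -, -, hpq⟩ := Module.Finite.exists_comp_eq_id_of_projective R S
  let e : Fin n → S := fun i => p (Pi.single i 1)
  let g : Fin n → S →ₗ[R] R := fun i => LinearMap.proj i ∘ₗ q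
  have hge : ∀ s, ∑ i, g i s • e i = s := fun s => by
    have h1 : p (q s) = s := LinearMap.congr_fun hpq s
    conv_rhs => rw [← h1, pi_eq_sum_univ' (q s)]
    simp [e, g]
  choose x hx using fun i => hsurj ((Algebra.linearMap R S) ∘ₗ g i)
  simp only [LinearMap.comp_apply, Algebra.linearMap_apply] at hx
  have hmem : ∀ i m, smashAction actM (x i) m ∈ N := fun i m => by
    rw [hN]
    intro a
    obtain ⟨z, hz, hz'⟩ := exists_smashAction_eq_mul hS h (1 ⊗ₜ a) (x i)
    -- Both sides have the same image under `j`, because `g i` takes values in `R`, where `a` acts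
    -- by `ε(a)`. Injectivity of `j` transfers the identity from `S` to `M`.
    have : z = Coalgebra.counit (R := K) a • x i := by
      apply hinj
      ext t
      rw [hz, map_smul, LinearMap.smul_apply, Module.End.mul_apply, hx, jMap_tmul, one_mul, hR]
    have h2 := LinearMap.congr_fun hz' m
    rw [this, map_smul, LinearMap.smul_apply, Module.End.mul_apply, smashAction_tmul, one_smul]
      at h2
    exact h2.symm
  have hone : ∑ i, e i • x i = 1 ⊗ₜ[K] 1 := by
    apply hinj
    ext t
    simp only [map_sum, LinearMap.sum_apply, jMap_tmul, map_one, Module.End.one_apply, one_mul]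
    conv_rhs => rw [← hge t]
    refine Finset.sum_congr rfl fun i _ => ?_
    rw [jMap_eq_smashAction, smashAction_smul, ← jMap_eq_smashAction, hx, smul_eq_mul, mul_comm,
      Algebra.smul_def]
  let ψ : M →+ S ⊗[R] N :=
    { toFun := fun m => ∑ i, e i ⊗ₜ[R] (⟨smashAction actM (x i) m, hmem i m⟩ : N)
      map_zero' := Finset.sum_eq_zero fun i _ => by
        rw [show (⟨smashAction actM (x i) 0, hmem i 0⟩ : N) = 0 from Subtype.ext (map_zero _),
          TensorProduct.tmul_zero]
      map_add' := fun m m' => by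
        simp only [map_add, ← Finset.sum_add_distrib, ← TensorProduct.tmul_add]
        rfl }
  refine Function.bijective_iff_has_inverse.2 ⟨ψ, fun y => ?_, fun m => ?_⟩
  · induction y with
    | zero => simp
    | add y y' hy hy' => rw [map_add, map_add, hy, hy']
    | tmul s m =>
      rw [extendScalars_tmul]
      -- The product of `x i` and `s # 1` acts on the invariant `m` through its value at `1 ∈ S`,
      -- which is `g i s`.
      have : ∀ i, (⟨smashAction actM (x i) (s • (m : M)), hmem i _⟩ : N) = g i s • m := fun i => by
        obtain ⟨z, hz, hz'⟩ := exists_smashAction_eq_mul hS h (x i) (s ⊗ₜ 1)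
        have h2 := LinearMap.congr_fun hz' m
        rw [smashAction_apply_of_invariant hS ((hN m).1 m.2), hz, Module.End.mul_apply,
          Module.End.mul_apply, smashAction_tmul, jMap_tmul, hx] at h2
        ext
        simpa using h2.symm
      change ∑ i, e i ⊗ₜ[R] (⟨smashAction actM (x i) (s • (m : M)), hmem i _⟩ : N) = _
      simp only [this, TensorProduct.tmul_smul, TensorProduct.smul_tmul', ← TensorProduct.sum_tmul,
        hge]
  · change extendScalars N
      (∑ i, e i ⊗ₜ[R] (⟨smashAction actM (x i) m, hmem i m⟩ : N)) = m
    simp only [map_sum, extendScalars_tmul, ← smashAction_smul]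
    rw [← LinearMap.sum_apply, ← map_sum, hone, smashAction_tmul]
    simp

end Smash

/-! ### Comodules over `H^*` as `H`-modules, and Hopf-Galois extensions -/

section Dual

variable {K H S M : Type*} [Field K] [Ring H] [HopfAlgebra K H] [Module.Finite K H]
  [CommRing S] [Algebra K S] [AddCommGroup M] [Module K M] [Module S M] [IsScalarTower K S M]

variable (K H M) in
/-- `M ⊗ H^* ≃ Hom(H, M)`, `m ⊗ f ↦ f(·) m`. -/
noncomputable def evalEquiv : M ⊗[K] Module.Dual K H ≃ₗ[K] (H →ₗ[K] M) :=
  (TensorProduct.comm K M (Module.Dual K H)).trans (dualTensorHomEquiv K H M)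

theorem evalEquiv_tmul (m : M) (f : Module.Dual K H) (h : H) :
    evalEquiv K H M (m ⊗ₜ f) h = f h • m := by
  simp [evalEquiv]

theorem evalEquiv_smul (s : S) (z : M ⊗[K] Module.Dual K H) (h : H) :
    evalEquiv K H M (s • z) h = s • evalEquiv K H M z h := by
  induction z with
  | zero => simp
  | add y y' hy hy' => simp only [map_add, LinearMap.add_apply, smul_add, hy, hy']
  | tmul m f => rw [TensorProduct.smul_tmul', evalEquiv_tmul, evalEquiv_tmul, smul_comm]

theorem evalEquiv_inducedCoaction (act : H →ₐ[K] Module.End K S) (s : S) :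
    evalEquiv K H S (inducedCoaction act s) = act.toLinearMap.flip s := by
  simp [evalEquiv, inducedCoaction]

/-- The unit of `H^*` is the counit of `H`, so this turns coinvariants into invariants of the
associated `H`-action. -/
theorem eq_tmul_counit_iff (z : M ⊗[K] Module.Dual K H) (m : M) :
    z = m ⊗ₜ[K] (Coalgebra.counit : Module.Dual K H) ↔
      ∀ h : H, evalEquiv K H M z h = Coalgebra.counit (R := K) h • m := by
  rw [← (evalEquiv K H M).injective.eq_iff, LinearMap.ext_iff]
  simp only [evalEquiv_tmul]

/-- The product of `H^*` is convolution, so evaluating a product at `h` evaluates the factors at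
`h₁` and `h₂`. It turns `ρ(s m) = σ(s) ρ(m)` into the smash module identity. -/
theorem evalEquiv_tensorSMul (y : S ⊗[K] Module.Dual K H) (z : M ⊗[K] Module.Dual K H) (h : H) :
    evalEquiv K H M (tensorSMul y z) h =
      TensorProduct.lift (Algebra.lsmul K K M : S →ₐ[K] Module.End K M).toLinearMap
        (TensorProduct.map (evalEquiv K H S y) (evalEquiv K H M z)
          (Coalgebra.comul (R := K) h)) := by
  induction y with
  | zero => simp
  | add y y' hy hy' => simp only [map_add, LinearMap.add_apply, hy, hy', TensorProduct.map_add_left]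
  | tmul s f =>
    induction z with
    | zero => simp
    | add y y' hy hy' =>
      simp only [map_add, LinearMap.add_apply, hy, hy', TensorProduct.map_add_right]
    | tmul m g =>
      have h1 : evalEquiv K H M (tensorSMul (s ⊗ₜ[K] f) (m ⊗ₜ[K] g)) h =
          TensorProduct.dualDistrib K H H (f ⊗ₜ g) (Coalgebra.comul (R := K) h) • s • m := by
        simp only [tensorSMul, TensorProduct.map₂_apply_tmul, TensorProduct.map_tmul,
          evalEquiv_tmul]
        rfl
      rw [h1]
      induction Coalgebra.comul (R := K) h with
      | zero => simp
      | add u v hu hv => simp only [map_add, add_smul, hu, hv]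
      | tmul a b =>
        simp only [TensorProduct.dualDistrib_apply, TensorProduct.map_tmul, TensorProduct.lift.tmul,
          evalEquiv_tmul, mul_smul, AlgHom.toLinearMap_apply, Algebra.lsmul_coe, smul_assoc]
        rw [smul_comm s (g b) m]

/-- The left `H`-action on a right `H^*`-comodule. -/
noncomputable def comoduleAction {σ : S →ₗ[K] S ⊗[K] Module.Dual K H}
    {ρ : M →ₗ[K] M ⊗[K] Module.Dual K H} (hρ : IsRelativeHopfModule σ ρ) :
    H →ₐ[K] Module.End K M :=
  AlgHom.ofLinearMap (((evalEquiv K H M).toLinearMap ∘ₗ ρ).flip)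
    (by
      ext m
      have h := hρ.counit m
      conv_rhs => rw [Module.End.one_apply, ← h]
      simp only [LinearMap.flip_apply, LinearMap.comp_apply, LinearEquiv.coe_coe]
      induction ρ m with
      | zero => simp
      | add y y' hy hy' => simp only [map_add, LinearMap.add_apply, hy, hy']
      | tmul m f => simp [evalEquiv_tmul, dualCounit])
    (fun h k => by
      ext m
      -- Evaluating at `h k` amounts to evaluating the coproduct with its second factor at `k` and
      -- its first at `h`; coassociativity then gives `(h k) m = h (k m)`.
      have h1 : ∀ z : M ⊗[K] Module.Dual K H, evalEquiv K H M z (h * k) =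
          evalEquiv K H M (evalEquiv K H (M ⊗[K] Module.Dual K H)
            ((TensorProduct.assoc K M (Module.Dual K H) (Module.Dual K H)).symm
              ((dualComul (K := K) (H := H)).lTensor M z)) k) h := fun z => by
        induction z with
        | zero => simp
        | add y y' hy hy' => simp only [map_add, LinearMap.add_apply, hy, hy']
        | tmul m f =>
          have h2 : ∀ w : Module.Dual K H ⊗[K] Module.Dual K H,
              evalEquiv K H M (evalEquiv K H (M ⊗[K] Module.Dual K H)
                ((TensorProduct.assoc K M (Module.Dual K H) (Module.Dual K H)).symm
                  (m ⊗ₜ w)) k) h = TensorProduct.dualDistrib K H H w (h ⊗ₜ k) • m := fun w => by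
            induction w with
            | zero => simp
            | add y y' hy hy' =>
              simp only [map_add, LinearMap.add_apply, hy, hy', TensorProduct.tmul_add, add_smul]
            | tmul f g =>
              rw [TensorProduct.assoc_symm_tmul, evalEquiv_tmul, map_smul, LinearMap.smul_apply,
                evalEquiv_tmul, TensorProduct.dualDistrib_apply, ← mul_smul, mul_comm]
          rw [LinearMap.lTensor_tmul, h2, evalEquiv_tmul]
          congr 1
          have h3 := LinearMap.congr_fun ((TensorProduct.dualDistribEquiv K H H).apply_symm_apply
            ((LinearMap.mul' K H).dualMap f)) (h ⊗ₜ k)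
          exact h3.symm
      have h4 : ∀ z : M ⊗[K] Module.Dual K H,
          evalEquiv K H (M ⊗[K] Module.Dual K H) (ρ.rTensor _ z) k =
            ρ (evalEquiv K H M z k) := fun z => by
        induction z with
        | zero => simp
        | add y y' hy hy' => simp only [map_add, LinearMap.add_apply, hy, hy']
        | tmul m f => simp [evalEquiv_tmul]
      simp only [LinearMap.flip_apply, LinearMap.comp_apply, LinearEquiv.coe_coe,
        Module.End.mul_apply]
      rw [h1, ← hρ.coassoc, LinearEquiv.symm_apply_apply, h4])

theorem comoduleAction_apply {σ : S →ₗ[K] S ⊗[K] Module.Dual K H}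
    {ρ : M →ₗ[K] M ⊗[K] Module.Dual K H} (hρ : IsRelativeHopfModule σ ρ) (h : H) (m : M) :
    comoduleAction hρ h m = evalEquiv K H M (ρ m) h := rfl

theorem IsRelativeHopfModule.isSmashModule {act : H →ₐ[K] Module.End K S}
    {ρ : M →ₗ[K] M ⊗[K] Module.Dual K H} (hρ : IsRelativeHopfModule (inducedCoaction act) ρ) :
    IsSmashModule act (comoduleAction hρ) := fun h s m => by
  rw [comoduleAction_apply, hρ.smul, evalEquiv_tensorSMul, evalEquiv_inducedCoaction, diagonalSMul]
  congr 1
  induction Coalgebra.comul (R := K) h with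
  | zero => simp
  | add u v hu hv => simp only [map_add, LinearMap.add_apply, hu, hv]
  | tmul a b => simp [comoduleAction_apply]

omit [Module.Finite K H] in
theorem IsModuleAlgebra.comp {A : Type*} [Ring A] [HopfAlgebra K A]
    {act : A →ₐ[K] Module.End K S} (hS : IsModuleAlgebra act) (ι : H →ₐc[K] A) :
    IsModuleAlgebra (act.comp (ι : H →ₐ[K] A)) where
  act_one h := by
    rw [AlgHom.comp_apply, hS.act_one]
    congr 1
    exact CoalgHomClass.counit_comp_apply ι h
  act_mul h s t := by
    have h1 : Coalgebra.comul (R := K) (ι h) =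
        TensorProduct.map (ι : H →ₗ[K] A) (ι : H →ₗ[K] A) (Coalgebra.comul (R := K) h) :=
      (CoalgHomClass.map_comp_comul_apply ι h).symm
    rw [AlgHom.comp_apply]
    refine (hS.act_mul _ s t).trans ?_
    simp only [diagonalSMul]
    congr 1
    change TensorProduct.map₂ _ _ (Coalgebra.comul (R := K) (ι h)) _ = _
    rw [h1]
    induction Coalgebra.comul (R := K) h with
    | zero => simp
    | add u v hu hv => simp only [map_add, LinearMap.add_apply, hu, hv]
    | tmul a b => simp

variable {R : Type*} [CommRing R] [Algebra R S]

/-- An element `∑ c i ⊗ b i` of the kernel defines an `S`-linear functional on `S ⊗ H^*` that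
vanishes on the image of `γ`, hence everywhere; its values on the dual basis are the `c i`. -/
theorem IsHopfGalois.jMap_injective {act : H →ₐ[K] Module.End K S}
    (hγ : IsHopfGalois R (inducedCoaction act)) : Function.Injective (jMap act) := by
  obtain ⟨γ, hγ⟩ := hγ
  rw [injective_iff_map_eq_zero]
  intro x hx
  let b := Module.finBasis K H
  obtain ⟨c, rfl⟩ : ∃ c : Fin (Module.finrank K H) → S, x = ∑ i, c i ⊗ₜ[K] b i := by
    obtain ⟨c, hc⟩ := TensorProduct.eq_repr_basis_right b x
    exact ⟨c, by rw [← hc, Finsupp.sum_fintype _ _ (by simp)]⟩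
  simp only [LinearMap.ext_iff, map_sum, LinearMap.sum_apply, jMap_tmul, LinearMap.zero_apply] at hx
  have h1 : ∀ y, ∑ i, c i * evalEquiv K H S (γ y) (b i) = 0 := fun y => by
    induction y with
    | zero => simp
    | add y y' hy hy' =>
      simp only [map_add, LinearMap.add_apply, mul_add, Finset.sum_add_distrib, hy, hy', add_zero]
    | tmul s t =>
      have h2 : ∀ h, evalEquiv K H S (s • inducedCoaction act t) h = s * act h t := fun h => by
        rw [evalEquiv_smul, evalEquiv_inducedCoaction]
        rfl
      simp only [hγ, h2, mul_left_comm _ s, ← Finset.mul_sum, hx, mul_zero]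
  refine Finset.sum_eq_zero fun i _ => ?_
  have h2 := h1 (γ.symm (1 ⊗ₜ b.coord i))
  simp only [LinearEquiv.apply_symm_apply, evalEquiv_tmul, Module.Basis.coord_apply,
    Module.Basis.repr_self] at h2
  rw [Finset.sum_eq_single i (fun j _ hj => by simp [hj]) (by simp)] at h2
  rw [show c i = 0 by simpa using h2, TensorProduct.zero_tmul]

/-- The functional `s ⊗ t ↦ s (f t)`, carried to `S ⊗ H^*` by the inverse of `γ`, is determined by
its values on the dual basis; these are the coefficients of the preimage of `f`. -/
theorem IsHopfGalois.exists_jMap_eq [Algebra K R] [IsScalarTower K R S]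
    {act : H →ₐ[K] Module.End K S}
    (hγ : IsHopfGalois R (inducedCoaction act)) (f : S →ₗ[R] S) :
    ∃ x, ∀ t, jMap act x t = f t := by
  obtain ⟨γ, hγ⟩ := hγ
  let b := Module.finBasis K H
  let F : S ⊗[R] S →ₗ[S] S := TensorProduct.AlgebraTensorModule.lift
    (LinearMap.toSpanSingleton S (S →ₗ[R] S) f)
  have hF : ∀ s t, F (s ⊗ₜ t) = s * f t := fun s t => by simp [F]
  refine ⟨∑ i, F (γ.symm (1 ⊗ₜ b.coord i)) ⊗ₜ b i, fun t => ?_⟩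
  have h1 : inducedCoaction act t = ∑ i, act (b i) t ⊗ₜ b.coord i := by
    apply (evalEquiv K H S).injective
    rw [evalEquiv_inducedCoaction]
    refine b.ext fun j => ?_
    simp [evalEquiv_tmul, Finsupp.single_apply]
  have h2 : F (γ.symm (γ (1 ⊗ₜ t))) = f t := by rw [γ.symm_apply_apply, hF, one_mul]
  rw [← h2, hγ, one_smul, h1]
  simp only [map_sum, LinearMap.sum_apply, jMap_tmul]
  refine Finset.sum_congr rfl fun i _ => ?_
  have h3 : act (b i) t ⊗ₜ b.coord i = act (b i) t • ((1 : S) ⊗ₜ[K] b.coord i) := by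
    rw [TensorProduct.smul_tmul', smul_eq_mul, mul_one]
  rw [h3, map_smul, map_smul, smul_eq_mul, mul_comm]

variable [Module R M] [IsScalarTower R S M] [Algebra K R] [IsScalarTower K R S]

/-- For a Hopf-Galois extension `S / R` that is finite projective, `S ⊗ M^{co H^*} → M` is
bijective for every relative Hopf module `M`. -/
theorem IsHopfGalois.bijective_extendScalars [Module.Finite R S] [Module.Projective R S]
    {act : H →ₐ[K] Module.End K S} {ρ : M →ₗ[K] M ⊗[K] Module.Dual K H}
    (hS : IsModuleAlgebra act) (hR : CoinvariantsEqBase R (inducedCoaction act))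
    (hρ : IsRelativeHopfModule (inducedCoaction act) ρ)
    (hγ : IsHopfGalois R (inducedCoaction act)) :
    Function.Bijective (extendScalars (S := S) (coinvariants hR hρ)) := by
  refine HopfShift.bijective_extendScalars hS hρ.isSmashModule (fun h r => ?_) hγ.jMap_injective
    hγ.exists_jMap_eq _ fun m => ?_
  · have := (eq_tmul_counit_iff _ _).1 ((hR.2 (algebraMap R S r)).2 ⟨r, rfl⟩) h
    rwa [evalEquiv_inducedCoaction] at this
  · exact eq_tmul_counit_iff _ _

end Dual

/-! ### Representations of a local ring with a character to a field -/

section LocalAction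

variable {k A : Type*} [Field k] [Ring A] [IsLocalRing A]

theorem isUnit_one_sub_of_map_eq_zero (χ : A →+* k) {a : A} (ha : χ a = 0) : IsUnit (1 - a) := by
  have h : ¬ IsUnit a := fun h => not_isUnit_zero (ha ▸ h.map χ)
  exact (IsLocalRing.isUnit_or_isUnit_of_add_one (add_sub_cancel a 1)).resolve_left h

/-- A nonzero finite dimensional representation of a local ring with residue field `k` contains a
nonzero invariant. -/
theorem exists_invariant {V : Type*} [AddCommGroup V] [Module k V] [Module.Finite k V]
    (χ : A →+* k) (ρ : A →+* Module.End k V) (hχ : ∀ c : k, ∃ b, χ b = c ∧ ρ b = c • 1)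
    (P : V → Prop) (hP : ∀ a v, P v → P (ρ a v)) {v : V} (hv : P v) (hv0 : v ≠ 0) :
    ∃ w, P w ∧ w ≠ 0 ∧ ∀ a, ρ a w = χ a • w := by
  let orbit : V → Submodule k V := fun v =>
    { carrier := Set.range fun a => ρ a v
      zero_mem' := ⟨0, by simp⟩
      add_mem' := by
        rintro _ _ ⟨a, rfl⟩ ⟨b, rfl⟩
        exact ⟨a + b, by simp⟩
      smul_mem' := by
        rintro c _ ⟨a, rfl⟩
        obtain ⟨b, -, hb⟩ := hχ c
        exact ⟨b * a, by simp [hb]⟩ }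
  obtain ⟨w, ⟨hw, hw0⟩, hmin⟩ := (measure fun v => Module.finrank k (orbit v)).wf.has_min
    {v | P v ∧ v ≠ 0} ⟨v, hv, hv0⟩
  have key : ∀ a, χ a = 0 → ρ a w = 0 := fun a ha => by
    by_contra h0
    have hle : orbit (ρ a w) ≤ orbit w := by
      rintro _ ⟨b, rfl⟩
      exact ⟨b * a, by simp⟩
    have heq := Submodule.eq_of_le_of_finrank_le hle (not_lt.1 (hmin _ ⟨hP a w hw, h0⟩))
    have hmem : w ∈ orbit (ρ a w) := heq ▸ ⟨1, by simp⟩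
    obtain ⟨b, hb⟩ := hmem
    have hu := isUnit_one_sub_of_map_eq_zero χ (a := b * a) (by simp [ha])
    have hz : ρ (1 - b * a) w = 0 := by
      simp only [map_sub, map_one, map_mul, LinearMap.sub_apply, Module.End.one_apply,
        Module.End.mul_apply]
      exact sub_eq_zero.2 hb.symm
    obtain ⟨u, hu⟩ := hu
    apply hw0
    have := congrArg (ρ (↑u⁻¹ : A)) hz
    rwa [← Module.End.mul_apply, ← map_mul, ← hu, Units.inv_mul, map_one, map_zero] at this
  refine ⟨w, hw, hw0, fun a => ?_⟩
  obtain ⟨b, hb, hb'⟩ := hχ (χ a)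
  have := key (a - b) (by simp [hb])
  rw [map_sub, LinearMap.sub_apply, sub_eq_zero] at this
  rw [this, hb']
  simp

/-- If `A` is local and the invariants of `A` in the algebra `T` are the scalars, then
`T ⊗ T → Map(A, T)`, `t ⊗ u ↦ (a ↦ (a t) u)`, is injective. -/
theorem eq_zero_of_forall_mul_rTensor_eq_zero {T : Type*} [CommRing T] [Algebra k T]
    [Module.Finite k T] (χ : A →+* k) (ρ : A →+* Module.End k T)
    (hχ : ∀ c : k, ∃ b, χ b = c ∧ ρ b = c • 1)
    (hinv : ∀ t : T, (∀ a, ρ a t = χ a • t) → ∃ c : k, algebraMap k T c = t) {z : T ⊗[k] T}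
    (hz : ∀ a, LinearMap.mul' k T ((ρ a).rTensor T z) = 0) : z = 0 := by
  by_contra hz0
  let ρ' : A →+* Module.End k (T ⊗[k] T) :=
    { toFun := fun a => (ρ a).rTensor T
      map_one' := by rw [map_one]; exact LinearMap.rTensor_id _ _
      map_zero' := by simp
      map_mul' := fun a b => by rw [map_mul, LinearMap.rTensor_mul]
      map_add' := fun a b => by rw [map_add, LinearMap.rTensor_add] }
  have hρ' : ∀ a y, ρ' a y = (ρ a).rTensor T y := fun a y => rfl
  -- The kernel is stable under the action on the left factor. A nonzero invariant `w` in it has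
  -- invariant, hence scalar, coefficients, so `w = 1 ⊗ u`; the condition at `a = 1` then reads `u =
  -- 0`.
  obtain ⟨w, hw, hw0, hwinv⟩ := exists_invariant χ ρ' (fun c => by
      obtain ⟨b, hb, hb'⟩ := hχ c
      refine ⟨b, hb, ?_⟩
      refine LinearMap.ext fun y => ?_
      rw [hρ', hb', LinearMap.rTensor_smul, LinearMap.smul_apply, LinearMap.smul_apply]
      congr 1
      exact LinearMap.congr_fun (LinearMap.rTensor_id _ _) y)
    (fun z => ∀ a, LinearMap.mul' k T ((ρ a).rTensor T z) = 0)
    (fun a v hv b => by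
      have := hv (b * a)
      rwa [map_mul, LinearMap.rTensor_mul] at this) hz hz0
  let b := Module.finBasis k T
  obtain ⟨c, rfl⟩ := TensorProduct.eq_repr_basis_right b w
  have hc : ∀ i, ∃ r : k, algebraMap k T r = c i := fun i => hinv _ fun a => by
    have h1 := hwinv a
    rw [hρ', Finsupp.sum_fintype _ _ (by simp)] at h1
    simp only [map_sum, LinearMap.rTensor_tmul, Finset.smul_sum, TensorProduct.smul_tmul'] at h1
    rw [← sub_eq_zero, ← Finset.sum_sub_distrib] at h1
    simp only [← TensorProduct.sub_tmul] at h1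
    have h2 := TensorProduct.sum_tmul_basis_right_eq_zero b
      (Finsupp.equivFunOnFinite.symm fun i => ρ a (c i) - χ a • c i)
      (by rw [Finsupp.sum_fintype _ _ (by simp)]; exact h1)
    exact sub_eq_zero.1 (DFunLike.congr_fun h2 i)
  choose r hr using hc
  have h1 : (c.sum fun i m => m ⊗ₜ[k] b i) = 1 ⊗ₜ[k] ∑ i, r i • b i := by
    rw [Finsupp.sum_fintype _ _ (by simp), TensorProduct.tmul_sum]
    refine Finset.sum_congr rfl fun i _ => ?_
    rw [← hr, Algebra.algebraMap_eq_smul_one, TensorProduct.smul_tmul]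
  have h2 := hw 1
  rw [h1, map_one, LinearMap.rTensor_tmul, LinearMap.mul'_apply, Module.End.one_apply, one_mul] at h2
  exact hw0 (by rw [h1, h2, TensorProduct.tmul_zero])

end LocalAction

/-! ### Vanishing Hopfological homology over a local base -/

section LocalHopf

variable {R A S : Type*} [CommRing R] [IsLocalRing R] [Ring A] [HopfAlgebra R A]
  [CommRing S] [Algebra R S] {act : A →ₐ[R] Module.End R S}

omit [IsLocalRing R] in
theorem act_mem_invariants {x : A} (hx : x ∈ leftIntegrals R A) (s : S) :
    act x s ∈ invariants act := fun a => by
  have h : a * x = Coalgebra.counit (R := R) a • x := hx a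
  rw [← Module.End.mul_apply, ← map_mul, h, map_smul, LinearMap.smul_apply]

/-- If the Hopfological homology of `S` vanishes and `S^A = R`, then some left integral takes the
value `1` on `S`. -/
theorem exists_integral_act_eq_one (hinv : InvariantsEqBase act)
    (h : Subsingleton (HopfologicalHomology act)) :
    ∃ x ∈ leftIntegrals R A, ∃ s : S, act x s = 1 := by
  by_contra! hne
  -- Each `x s` lies in `R`. If it were a unit there, rescaling `s` would give the value `1`;
  -- otherwise all of `I S` lies in the maximal ideal, although vanishing homology puts `1` in `I
  -- S`.
  have hle : integralImage act ≤
      Submodule.map (Algebra.linearMap R S) (IsLocalRing.maximalIdeal R) := by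
    refine Submodule.map₂_le.2 fun x hx s _ => ?_
    obtain ⟨r, hr⟩ := (hinv.2 _).1 (act_mem_invariants hx s)
    refine ⟨r, fun hu => ?_, hr⟩
    obtain ⟨u, rfl⟩ := hu
    apply hne x hx ((↑u⁻¹ : R) • s)
    rw [map_smul, ← hr, Algebra.smul_def, ← map_mul]
    simp
  have h1 : (1 : S) ∈ invariants act := (hinv.2 1).2 ⟨1, map_one _⟩
  have h2 : (1 : S) ∈ integralImage act :=
    (Submodule.Quotient.mk_eq_zero ((integralImage act).submoduleOf (invariants act)) (x := (⟨1, h1⟩ : invariants act))).1 (Subsingleton.elim _ _)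
  obtain ⟨r, hr, hr1⟩ := hle h2
  have : r = 1 := hinv.1 (by simpa using hr1)
  subst this
  exact hr isUnit_one

open IsLocalRing in
-- By Nakayama, multiplication by `d` is surjective on `S` once it is so modulo the maximal ideal.
theorem isUnit_of_isUnit_one_tmul [Module.Finite R S] {d : S}
    (h : IsUnit ((1 : ResidueField R) ⊗ₜ[R] d)) : IsUnit d := by
  have hsurj := TensorProduct.mk_surjective R S (ResidueField R) Ideal.Quotient.mk_surjective
  have h1 : LinearMap.range (LinearMap.mulLeft R d) = ⊤ := by
    rw [← map_tensorProduct_mk_eq_top, eq_top_iff]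
    rintro y -
    obtain ⟨v, hv⟩ := h.exists_right_inv
    obtain ⟨u, hu⟩ := hsurj (v * y)
    refine ⟨d * u, ⟨u, rfl⟩, ?_⟩
    rw [TensorProduct.mk_apply] at hu ⊢
    rw [← one_mul (1 : ResidueField R), ← Algebra.TensorProduct.tmul_mul_tmul, hu, ← mul_assoc, hv,
      one_mul]
  obtain ⟨e, he⟩ : (1 : S) ∈ LinearMap.range (LinearMap.mulLeft R d) := h1 ▸ trivial
  exact IsUnit.of_mul_eq_one e he

open IsLocalRing in
/-- If `s` has image `1` under a left integral and `S^A = R`, then the invariants of `k ⊗ S` are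
the scalars, where `k` is the residue field of `R`. -/
theorem residueField_invariants (hinv : InvariantsEqBase act) (hS : IsModuleAlgebra act)
    {x : A} (hx : x ∈ leftIntegrals R A) {s : S} (hs : act x s = 1)
    (t : ResidueField R ⊗[R] S)
    (ht : ∀ a, (act a).baseChange (ResidueField R) t =
      residue R (Coalgebra.counit (R := R) a) • t) :
    ∃ c, algebraMap (ResidueField R) (ResidueField R ⊗[R] S) c = t := by
  obtain ⟨t, rfl⟩ := TensorProduct.mk_surjective R S (ResidueField R) Ideal.Quotient.mk_surjective t
  -- Modulo the maximal ideal `x (s t) = ∑ (x₁ s) (x₂ t) = (x s) t = t`, since `x₂` acts on `t`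
  -- through the counit; and `x (s t)` lies in `S^A = R`.
  simp only [TensorProduct.mk_apply, LinearMap.baseChange_tmul] at ht ⊢
  have key : ∀ u : A ⊗[R] A, (1 : ResidueField R) ⊗ₜ[R]
      (TensorProduct.lift (Algebra.lsmul R R S : S →ₐ[R] Module.End R S).toLinearMap
        (TensorProduct.map₂ act.toLinearMap act.toLinearMap u (s ⊗ₜ[R] t))) =
      1 ⊗ₜ (act (TensorProduct.rid R A (Coalgebra.counit.lTensor A u)) s * t) := fun u => by
    induction u with
    | zero => simp
    | add u v hu hv =>
      simp only [map_add, LinearMap.add_apply, TensorProduct.tmul_add, add_mul, hu, hv]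
    | tmul a b =>
      simp only [TensorProduct.map₂_apply_tmul, TensorProduct.map_tmul, TensorProduct.lift.tmul,
        AlgHom.toLinearMap_apply, Algebra.lsmul_coe, smul_eq_mul, LinearMap.lTensor_tmul,
        TensorProduct.rid_tmul, map_smul, LinearMap.smul_apply]
      rw [← one_mul (1 : ResidueField R), ← Algebra.TensorProduct.tmul_mul_tmul, ht,
        ← Algebra.TensorProduct.tmul_mul_tmul]
      rw [TensorProduct.tmul_smul, smul_mul_assoc, mul_smul_comm]
      rfl
  have h1 := key (Coalgebra.comul (R := R) x)
  rw [Coalgebra.lTensor_counit_comul, TensorProduct.rid_tmul, one_smul, hs, one_mul] at h1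
  rw [← h1]
  change ∃ c, _ = 1 ⊗ₜ diagonalSMul act act x s t
  rw [← hS.act_mul]
  obtain ⟨r, hr⟩ := (hinv.2 (act x (s * t))).1 (act_mem_invariants hx _)
  refine ⟨residue R r, ?_⟩
  rw [← hr, Algebra.TensorProduct.algebraMap_apply, Algebra.algebraMap_eq_smul_one (A := S),
    ← TensorProduct.smul_tmul, Algebra.smul_def, mul_one]
  rfl

open IsLocalRing in
/-- Let `A` be local and let `S` and `A` have the same rank. If some left integral takes the value
`1` on `S` and `S^A = R`, then `S # A ≃ End_R(S)`. -/
theorem jMap_bijective_of_integral [IsLocalRing A] [Module.Finite R A] [Module.Projective R A]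
    [Module.Finite R S] [Module.Projective R S] (hinv : InvariantsEqBase act)
    (hS : IsModuleAlgebra act) (hrank : Module.finrank R S = Module.finrank R A)
    {x : A} (hx : x ∈ leftIntegrals R A) {s : S} (hs : act x s = 1) :
    Function.Bijective (jMap act) := by
  have := Module.free_of_flat_of_isLocalRing (R := R) (P := A)
  have := Module.free_of_flat_of_isLocalRing (R := R) (P := S)
  let bS := Module.finBasis R S
  let bA := Module.finBasisOfFinrankEq R A hrank.symm
  let φ : S →ₐ[R] ResidueField R ⊗[R] S := Algebra.TensorProduct.includeRight
  -- The transpose of `Q` represents `j` in the chosen bases over `S`; equality of ranks makes it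
  -- square.
  let Q : Matrix (Fin (Module.finrank R S)) (Fin (Module.finrank R S)) S :=
    Matrix.of fun j i => act (bA j) (bS i)
  let ρ : A →+* Module.End (ResidueField R) (ResidueField R ⊗[R] S) :=
    (Module.End.baseChangeHom R (ResidueField R) S).toRingHom.comp act.toRingHom
  have hρ : ∀ a, ρ a = (act a).baseChange (ResidueField R) := fun a => rfl
  let χ : A →+* ResidueField R := (residue R).comp (Bialgebra.counitAlgHom R A).toRingHom
  have hQ : IsUnit Q := by
    have hinj : Function.Injective (Q.map φ).mulVecLin := by
      rw [injective_iff_map_eq_zero]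
      intro v hv
      let b := bS.baseChange (ResidueField R)
      -- A kernel vector `v` of `Q` over `k ⊗ S` is encoded as the tensor `∑ b i ⊗ v i`; the rows of
      -- `Q` test it on a basis of `A`, hence on all of `A`.
      have hz := eq_zero_of_forall_mul_rTensor_eq_zero (k := ResidueField R) χ ρ
        (fun c => by
          obtain ⟨r, rfl⟩ := residue_surjective c
          refine ⟨algebraMap R A r, by simp [χ], ?_⟩
          rw [hρ, AlgHom.commutes, Algebra.algebraMap_eq_smul_one, LinearMap.baseChange_smul,
            show LinearMap.baseChange (ResidueField R) (1 : Module.End R S) = 1 from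
              LinearMap.baseChange_id]
          rfl)
        (residueField_invariants hinv hS hx hs) (z := ∑ i, b i ⊗ₜ v i) (fun a => by
          have h1 : ∀ a, LinearMap.mul' (ResidueField R) (ResidueField R ⊗[R] S)
              ((ρ a).rTensor _ (∑ i, b i ⊗ₜ v i)) = ∑ i, φ (act a (bS i)) * v i := fun a => by
            simp only [map_sum, LinearMap.rTensor_tmul, LinearMap.mul'_apply, hρ, b,
              Module.Basis.baseChange_apply, LinearMap.baseChange_tmul]
            rfl
          have h2 : ∀ j, ∑ i, φ (act (bA j) (bS i)) * v i = 0 := fun j => congrFun hv j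
          rw [h1, ← bA.sum_repr a]
          simp only [map_sum, map_smul, LinearMap.sum_apply, LinearMap.smul_apply, Finset.sum_mul,
            smul_mul_assoc]
          rw [Finset.sum_comm]
          simp only [← Finset.smul_sum, h2, smul_zero, Finset.sum_const_zero])
      have hz' := TensorProduct.sum_tmul_basis_left_eq_zero b (Finsupp.equivFunOnFinite.symm v)
        (by rw [Finsupp.sum_fintype _ _ (by simp)]; exact hz)
      ext1 i
      exact DFunLike.congr_fun hz' i
    -- Over the residue field this is an injective endomorphism of a finite-dimensional space.
    have hsurj : Function.Surjective (Q.map φ).mulVec :=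
      LinearMap.surjective_of_injective (K := ResidueField R)
        (f := (Q.map φ).mulVecLin.restrictScalars (ResidueField R)) hinj
    have h1 := Matrix.mulVec_surjective_iff_isUnit.1 hsurj
    rw [Matrix.isUnit_iff_isUnit_det] at h1 ⊢
    apply isUnit_of_isUnit_one_tmul (R := R)
    change IsUnit (φ Q.det)
    rwa [AlgHom.map_det]
  have hQt : IsUnit Q.transpose := (Matrix.isUnit_transpose Q).2 hQ
  have hj : ∀ (c : Fin (Module.finrank R S) → S) i,
      jMap act (∑ j, c j ⊗ₜ bA j) (bS i) = Q.transpose.mulVec c i := fun c i => by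
    simp only [map_sum, LinearMap.sum_apply, jMap_tmul]
    exact Finset.sum_congr rfl fun j _ => mul_comm _ _
  have hrepr : ∀ y : S ⊗[R] A, ∃ c : Fin (Module.finrank R S) → S, y = ∑ j, c j ⊗ₜ bA j := by
    intro y
    obtain ⟨c, hc⟩ := TensorProduct.eq_repr_basis_right bA y
    exact ⟨c, by rw [← hc, Finsupp.sum_fintype _ _ (by simp)]⟩
  constructor
  · rw [injective_iff_map_eq_zero]
    intro y hy
    obtain ⟨c, rfl⟩ := hrepr y
    have h1 : Q.transpose.mulVec c = Q.transpose.mulVec 0 := by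
      ext1 i
      rw [← hj, hy, Matrix.mulVec_zero]
      rfl
    have h2 : c = 0 := Matrix.mulVec_injective_of_isUnit hQt h1
    simp [h2]
  · intro f
    obtain ⟨c, hc⟩ := Matrix.mulVec_surjective_iff_isUnit.2 hQt (fun i => f (bS i))
    exact ⟨∑ j, c j ⊗ₜ bA j, bS.ext fun i => (hj c i).trans (congrFun hc i)⟩

end LocalHopf

end HopfShift

/-! ### Assembly of both parts -/

theorem theorem2 :
    -- the one-sided bar construction
    (∀ (R A S M : Type*) [CommRing R] [IsLocalRing R]
      [Ring A] [HopfAlgebra R A] [Module.Finite R A] [Module.Projective R A]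
      [CommRing S] [Algebra R S] [Module.Finite R S] [Module.Projective R S]
      [AddCommGroup M] [Module R M] [Module S M] [IsScalarTower R S M]
      (act : A →ₐ[R] Module.End R S) (actM : A →ₐ[R] Module.End R M),
      Function.Bijective (HopfAlgebra.antipode R (A := A)) →
      HopfShift.IsModuleAlgebra act →
      HopfShift.IsFaithfulAction act →
      HopfShift.InvariantsEqBase act →
      HopfShift.IsSmashModule act actM →
      (Function.Bijective (HopfShift.jMap act) →
        HopfShift.IsDegreeShift (S := S) (HopfShift.invariants actM)) ∧
      (IsLocalRing A → Coalgebra.IsCocomm R A →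
        Module.finrank R S = Module.finrank R A →
        Subsingleton (HopfShift.HopfologicalHomology act) →
        HopfShift.IsDegreeShift (S := S) (HopfShift.invariants actM))) ∧
    -- relative Hopf modules
    (∀ (K 𝓗 H R S M : Type*) [Field K] [Ring 𝓗] [HopfAlgebra K 𝓗]
      [Ring H] [HopfAlgebra K H] [Module.Finite K H]
      [CommRing R] [CommRing S] [Algebra K R] [Algebra K S] [Algebra R S] [IsScalarTower K R S]
      [AddCommGroup M] [Module K M] [Module R M] [Module S M]
      [IsScalarTower K S M] [IsScalarTower R S M]
      (ι : H →ₐc[K] 𝓗) (act : 𝓗 →ₐ[K] Module.End K S)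
      (ρ : M →ₗ[K] M ⊗[K] Module.Dual K H),
      Function.Injective ι →
      Function.Bijective (HopfAlgebra.antipode K (A := H)) →
      HopfShift.IsModuleAlgebra act →
      HopfShift.IsFaithfulAction (act.comp (ι : H →ₐ[K] 𝓗)) →
      Module.Finite R S → Module.Projective R S → Module.FaithfullyFlat R S →
      ∀ (hR : HopfShift.CoinvariantsEqBase R
          (HopfShift.inducedCoaction (act.comp (ι : H →ₐ[K] 𝓗))))
        (hρ : HopfShift.IsRelativeHopfModule
          (HopfShift.inducedCoaction (act.comp (ι : H →ₐ[K] 𝓗))) ρ),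
        HopfShift.IsHopfGalois R (HopfShift.inducedCoaction (act.comp (ι : H →ₐ[K] 𝓗))) →
        HopfShift.IsDegreeShift (S := S) (HopfShift.coinvariants hR hρ)) := by

  refine ⟨?_, ?_⟩
  · intro R A S M _ _ _ _ _ _ _ _ _ _ _ _ _ _ act actM _ hS _ hinv hM
    have main : Function.Bijective (HopfShift.jMap act) →
        HopfShift.IsDegreeShift (S := S) (HopfShift.invariants actM) := fun hj =>
      -- Here the base of the Hopf algebra and the ring of invariants are the same ring `R`.
      HopfShift.isDegreeShift_of_bijective _ (HopfShift.bijective_extendScalars hS hM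
        (fun a r => (hinv.2 _).2 ⟨r, rfl⟩ a) hj.1
        (fun f => (hj.2 f).imp fun x hx t => LinearMap.congr_fun hx t) _ fun m => Iff.rfl)
    refine ⟨main, fun _ _ hrank hH => main ?_⟩
    obtain ⟨x, hx, s, hs⟩ := HopfShift.exists_integral_act_eq_one hinv hH
    exact HopfShift.jMap_bijective_of_integral hinv hS hrank hx hs
  · intro K 𝓗 H R S M _ _ _ _ _ _ _ _ _ _ _ _ _ _ _ _ _ _ ι act ρ _ _ hS _ _ _ _ hR hρ hγ
    exact HopfShift.isDegreeShift_of_bijective _ (hγ.bijective_extendScalars (hS.comp ι) hR hρ)
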